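/- Let $A$ be a compact metric space, $\mathcal M(A)$ the space of Borel probability measures on $A$ with the topology of weak convergence, and $\mathcal U_A$ the space of bounded continuous functions $A\times\mathcal M(A)\to\mathbb R$ with the sup-norm topology and its Borel $\sigma$-algebra. A large game is a measurable map $G:(I,\mathcal I,\lambda)\to\mathcal U_A$, $i\mapsto u_i$, on an atomless probability space. A randomized strategy profile of $G$ is a measurable map $g:I\to\mathcal M(A)$; its societal summary is $s(g)=\int_I g(i)\,d\lambda(i)\in\mathcal M(A)$; it is a Nash equilibrium of $G$ if for $\lambda$-almost all $i$, $\int_A u_i(a,s(g))\,g(i,da)\ge\int_A u_i(a,s(g))\,d\mu(a)$ for all $\mu\in\mathcal M(A)$. An auxiliary mapping of $G$ associated with an equilibrium action distribution $\tau^*$ (the societal summary of some Nash equilibrium of $G$) is a function $\overline g:\mathcal U_A\to\mathcal M(A)$ such that $\overline g\circ G$ is a Nash equilibrium of $G$ with $s(\overline g\circ G)=\tau^*$. For each integer $n\ge 1$ let $I_n$ be a set of $n$ players with the uniform probability measure $\lambda_n$, and let $G_n:I_n\to\mathcal U_A$, $i\mapsto u^n_i$, be a finite-player game. For a randomized strategy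 profile $h:I_n\to\mathcal M(A)$, player $i$'s expected payoff is $U^n_i(h)=\int_{A^{I_n}}u^n_i\bigl(a_i,\tfrac1n\sum_{j\in I_n}\delta_{a_j}\bigr)\prod_{j\in I_n}h(j,da_j)$. The profile $h$ is an $\varepsilon$-Nash equilibrium of $G_n$ if there is $S\subseteq I_n$ with $\lambda_n(S)\ge 1-\varepsilon$ such that for all $i\in S$ and all $\mu\in\mathcal M(A)$, $U^n_i(h)\ge U^n_i(\mu,h_{-i})-\varepsilon$. A pure strategy profile $f:I_n\to A$ is a pure-strategy $\varepsilon$-Nash equilibrium if the profile $j\mapsto\delta_{f(j)}$ is an $\varepsilon$-Nash equilibrium. **Theorem.** Suppose that $G_n(I_n)\subseteq\operatorname{supp}\lambda G^{-1}$ for every $n$ and that $(G_n)$ converges to the large game $G$, i.e. $\lambda_nG_n^{-1}\to\lambda G^{-1}$ weakly on $\mathcal U_A$. Let $\overline g$ be an auxiliary mapping of $G$ whose restriction to $\operatorname{supp}\lambda G^{-1}$ is continuous at $\lambda G^{-1}$-almost every point of $\operatorname{supp}\lambda G^{-1}$, and let $g^n=\overline g\circ G_n$ be the direct strategy profiles.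 Let $(\Omega,\Sigma,\mathbb P)$ be a probability space and, for each $n$ and $i\in I_n$, let $x^n_i:\Omega\to A$ be a random variable with distribution $g^n(i)$ such that, for each $n$, the family $(x^n_i)_{i\in I_n}$ is pairwise independent. Then for every $\varepsilon>0$ the sets $$\Omega^n_\varepsilon=\{\omega\in\Omega:\ i\mapsto x^n_i(\omega)\text{ is a pure-strategy }\varepsilon\text{-Nash equilibrium of }G_n\}$$ are events, and $\lim_{n\to\infty}\mathbb P(\Omega^n_\varepsilon)=1$. -/

import Mathlib

open MeasureTheory ProbabilityTheory Filter Topology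
open scoped ENNReal BoundedContinuousFunction

namespace LargeGames

/-- The characteristic space `𝓤_A`: bounded continuous functions on `A × 𝓜(A)`, with the sup-norm
metric. `𝓜(A)` is `ProbabilityMeasure A` with the topology of weak convergence. -/
abbrev Payoff (A : Type*) [MetricSpace A] [MeasurableSpace A] [BorelSpace A] : Type _ :=
  (A × ProbabilityMeasure A) →ᵇ ℝ

section

variable {A : Type*} [MetricSpace A] [MeasurableSpace A] [BorelSpace A]

/-- The Borel σ-algebra of the sup-norm topology on the characteristic space. -/
noncomputable instance instMeasurableSpacePayoff : MeasurableSpace (Payoff A) := borel _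

instance instBorelSpacePayoff : BorelSpace (Payoff A) := ⟨rfl⟩

end

/-- A measure is atomless: every measurable set of positive measure has a measurable subset of
strictly smaller positive measure. -/
def IsAtomless {I : Type*} [MeasurableSpace I] (m : Measure I) : Prop :=
  ∀ s, MeasurableSet s → 0 < m s → ∃ t, t ⊆ s ∧ MeasurableSet t ∧ 0 < m t ∧ m t < m s

/-- A large game: an atomless probability space of players together with a measurable assignment
of payoff functions to players. -/
structure LargeGame (I : Type*) [MeasurableSpace I]
    (A : Type*) [MetricSpace A] [MeasurableSpace A] [BorelSpace A] where
  /-- the distribution of players -/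
  lam : ProbabilityMeasure I
  atomless : IsAtomless (lam : Measure I)
  /-- the payoff function of each player -/
  payoff : I → Payoff A
  measurable_payoff : Measurable payoff

/-- The societal summary `s(g) = ∫ g(i) dλ(i)` of a randomized strategy profile. -/
noncomputable def societalSummary {I : Type*} [MeasurableSpace I] {A : Type*} [MeasurableSpace A]
    (lam : ProbabilityMeasure I) (g : I → ProbabilityMeasure A) (hg : Measurable g) :
    ProbabilityMeasure A :=
  ⟨(lam : Measure I).bind (fun i => (g i : Measure A)),
    isProbabilityMeasure_bind (measurable_subtype_coe.comp hg).aemeasurable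
      (Eventually.of_forall fun i => (g i).2)⟩

namespace LargeGame

variable {I : Type*} [MeasurableSpace I] {A : Type*} [MetricSpace A] [MeasurableSpace A]
  [BorelSpace A]

/-- The distribution `λ G⁻¹` of characteristics in a large game. -/
noncomputable def charDist (G : LargeGame I A) : ProbabilityMeasure (Payoff A) :=
  G.lam.map G.measurable_payoff.aemeasurable

/-- Randomized strategy Nash equilibrium of a large game: almost every player's strategy
maximizes expected payoff against the societal summary. -/
def IsNash (G : LargeGame I A) (g : I → ProbabilityMeasure A) (hg : Measurable g) : Prop :=
  ∀ᵐ i ∂(G.lam : Measure I), ∀ μ : ProbabilityMeasure A,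
    ∫ a, G.payoff i (a, societalSummary G.lam g hg) ∂(μ : Measure A) ≤
      ∫ a, G.payoff i (a, societalSummary G.lam g hg) ∂(g i : Measure A)

/-- `τ` is an equilibrium action distribution: the societal summary of some Nash equilibrium. -/
def IsEquilibriumDist (G : LargeGame I A) (τ : ProbabilityMeasure A) : Prop :=
  ∃ (g : I → ProbabilityMeasure A) (hg : Measurable g),
    G.IsNash g hg ∧ societalSummary G.lam g hg = τ

/-- `gbar` is an auxiliary mapping associated with the action distribution `τ`: the composition
`gbar ∘ G` is a (measurable) randomized strategy profile, it is a Nash equilibrium, and its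
societal summary is `τ`. -/
def IsAuxiliaryMapping (G : LargeGame I A) (τ : ProbabilityMeasure A)
    (gbar : Payoff A → ProbabilityMeasure A) : Prop :=
  ∃ h : Measurable (gbar ∘ G.payoff),
    G.IsNash (gbar ∘ G.payoff) h ∧ societalSummary G.lam (gbar ∘ G.payoff) h = τ

end LargeGame

/-- The image of the uniform probability measure on a finite nonempty set `J` under `y : J → X`,
that is `∑ j, (1 / |J|) δ_{y j}`. -/
noncomputable def empirical {J : Type*} [Fintype J] [Nonempty J] {X : Type*} [MeasurableSpace X]
    (y : J → X) : ProbabilityMeasure X :=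
  ⟨∑ j, (Fintype.card J : ℝ≥0∞)⁻¹ • Measure.dirac (y j), ⟨by
    simp [Measure.finsetSum_apply,
      ENNReal.mul_inv_cancel (Nat.cast_ne_zero.2 Fintype.card_ne_zero) (ENNReal.natCast_ne_top _)]⟩⟩

section FiniteGames

variable {J : Type*} [Fintype J] [Nonempty J] {A : Type*} [MetricSpace A] [MeasurableSpace A]
  [BorelSpace A]

/-- Expected payoff of player `i` with payoff function `u` in a finite-player game with player
set `J`, under the randomized strategy profile `g`: the actions are drawn from the product of the
measures `g j`, and `u` is evaluated at the own action and the action distribution. -/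
noncomputable def expectedPayoff (u : Payoff A) (g : J → ProbabilityMeasure A) (i : J) : ℝ :=
  ∫ a : J → A, u (a i, empirical a) ∂(Measure.pi fun j => (g j : Measure A))

open Classical in
/-- `ε`-Nash equilibrium of the finite-player game `u : J → 𝓤_A`: all players outside a set of
proportion at most `ε` cannot gain more than `ε` by a unilateral deviation to any randomized
strategy. -/
def IsEpsNash (u : J → Payoff A) (ε : ℝ) (g : J → ProbabilityMeasure A) : Prop :=
  ∃ S : Finset J, 1 - ε ≤ (S.card : ℝ) / (Fintype.card J : ℝ) ∧
    ∀ i ∈ S, ∀ μ : ProbabilityMeasure A,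
      expectedPayoff (u i) (Function.update g i μ) i - ε ≤ expectedPayoff (u i) g i

/-- A pure strategy profile `f` is an `ε`-Nash equilibrium if the randomized strategy profile
`j ↦ δ_{f j}` that it induces is one. -/
def IsPureEpsNash (u : J → Payoff A) (ε : ℝ) (f : J → A) : Prop :=
  IsEpsNash u ε fun j => diracProba (f j)

end FiniteGames

end LargeGames

/-! Whether a player is nearly optimal is measured against the limit distribution `τ`, by two
functionals of the payoff `u`: the `regret` of the chosen action against `τ`, and the `oscillation`
of `u` when `τ` is perturbed within a neighbourhood `U`. Both are truncated at `1`, because payoffs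
are not uniformly bounded. If their averages over the players are small and `U` contains the
realized action distribution and all its unilateral deviations, Markov's inequality over the players
gives an `ε`-equilibrium (`isPureEpsNash_of_mean_lt`).

Three averages have to be controlled. For fixed `u`, compactness of `A` makes the oscillation vanish
as `U` shrinks to `τ`, so some `U` has small mean oscillation under the limit characteristics; the
functional is continuous in `u`, so this passes to `Gn`. The expected regret `∫ regret τ u d(gbar
u)` has integral zero in the limit by the Nash property, and inherits almost everywhere continuity
on the support from `gbar`; weak convergence then sends its mean in `Gn` to zero
(`tendsto_mean_regret`), and Markov's inequality over `Ω` handles the realized mean. Finally,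
expected action frequencies converge to `τ` for the same reason (`tendsto_mean_integral`), and
Chebyshev's inequality, for which pairwise independence suffices, puts the realized frequencies in
`U` with probability tending to one. -/

namespace LargeGames

/-! ### Weak convergence and integrands continuous almost everywhere relative to a set. -/

section AlmostEverywhereContinuous

variable {X : Type*} [PseudoMetricSpace X]

/-- Truncated sup-convolution of `F` over `S`: a Lipschitz majorant of `F` on `S`. -/
noncomputable def supConv (F : X → ℝ) (S : Set X) (C : ℝ) (k : ℕ) (x : X) : ℝ :=
  max (-C) (⨆ w : S, (F w - k * dist x w))

variable {F : X → ℝ} {S : Set X} {C : ℝ}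

lemma supConv_bddAbove (hC : ∀ x, |F x| ≤ C) (k : ℕ) (x : X) :
    BddAbove (Set.range fun w : S => F w - k * dist x w) := by
  refine ⟨C, ?_⟩
  rintro _ ⟨w, rfl⟩
  have h1 := (abs_le.1 (hC w)).2
  have h2 : (0 : ℝ) ≤ k * dist x w := by positivity
  simp only
  linarith

lemma le_supConv (hC : ∀ x, |F x| ≤ C) (k : ℕ) {x : X} (hx : x ∈ S) :
    F x ≤ supConv F S C k x := by
  refine le_max_of_le_right ?_
  simpa using le_ciSup (supConv_bddAbove hC k x) ⟨x, hx⟩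

/-- The cutoff at `-C` supplies the lower bound far from `S`, where the penalty dominates. -/
lemma abs_supConv_le [Nonempty S] (hC : ∀ x, |F x| ≤ C) (k : ℕ) (x : X) :
    |supConv F S C k x| ≤ C := by
  have hC0 : 0 ≤ C := (abs_nonneg _).trans (hC x)
  refine abs_le.2 ⟨le_max_left _ _, max_le (by linarith) (ciSup_le fun w => ?_)⟩
  have h1 := (abs_le.1 (hC w)).2
  have h2 : (0 : ℝ) ≤ k * dist x w := by positivity
  linarith

lemma continuous_supConv [Nonempty S] (hC : ∀ x, |F x| ≤ C) (k : ℕ) :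
    Continuous (supConv F S C k) := by
  refine continuous_const.max ?_
  refine (LipschitzWith.of_le_add_mul (k : NNReal) fun x y => ciSup_le fun w => ?_).continuous
  have h1 := le_ciSup (supConv_bddAbove hC k y) w
  have h2 : (k : ℝ) * dist y w ≤ k * (dist x y + dist x w) := by
    gcongr
    rw [dist_comm x y]
    exact dist_triangle y x w
  simp only [NNReal.coe_natCast] at h1 ⊢
  linarith

lemma tendsto_supConv [Nonempty S] (hC : ∀ x, |F x| ≤ C) {x : X} (hx : x ∈ S)
    (hF : ContinuousWithinAt F S x) :
    Tendsto (fun k => supConv F S C k x) atTop (𝓝 (F x)) := by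
  have hC0 : 0 ≤ C := (abs_nonneg _).trans (hC x)
  rw [Metric.tendsto_atTop]
  intro η hη
  obtain ⟨δ, hδ, hd⟩ := Metric.continuousWithinAt_iff.1 hF (η / 2) (by positivity)
  -- Once `k * δ ≥ 2 * C`, points `w` at distance at least `δ` contribute at most `C - 2 * C = -C ≤
  -- F x`, so only points near `x` matter.
  obtain ⟨N, hN⟩ := exists_nat_ge (2 * C / δ)
  refine ⟨N, fun k hk => ?_⟩
  have hkδ : 2 * C ≤ k * δ := by
    have : (N : ℝ) ≤ k := by exact_mod_cast hk
    exact (div_le_iff₀ hδ).1 (hN.trans this)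
  have hlow := le_supConv (S := S) hC k hx
  have hFx := abs_le.1 (hC x)
  have hup : supConv F S C k x ≤ F x + η / 2 := by
    refine max_le (by linarith) (ciSup_le fun w => ?_)
    by_cases hw : dist x w < δ
    · have h1 := hd w.2 (by rwa [dist_comm])
      rw [Real.dist_eq] at h1
      have h2 := (abs_lt.1 h1).2
      have h3 : (0 : ℝ) ≤ k * dist x w := by positivity
      linarith
    · have h1 := (abs_le.1 (hC w)).2
      have h2 : (k : ℝ) * δ ≤ k * dist x w := by
        have := not_lt.1 hw
        gcongr
      linarith
  rw [Real.dist_eq, abs_lt]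
  constructor <;> linarith

variable [MeasurableSpace X] [BorelSpace X]

/-- `F` is an almost everywhere limit of the continuous functions `supConv F S C k`; no
measurability of `F` has to be assumed. -/
lemma aestronglyMeasurable_of_ae_continuousWithinAt {μ : ProbabilityMeasure X}
    (hSμ : ∀ᵐ x ∂(μ : Measure X), x ∈ S) (hC : ∀ x, |F x| ≤ C)
    (hF : ∀ᵐ x ∂(μ : Measure X), ContinuousWithinAt F S x) :
    AEStronglyMeasurable F (μ : Measure X) := by
  have : Nonempty S := hSμ.exists.elim fun x hx => ⟨⟨x, hx⟩⟩
  refine aestronglyMeasurable_of_tendsto_ae atTop (f := supConv F S C)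
    (fun k => (continuous_supConv hC k).measurable.aestronglyMeasurable) ?_
  filter_upwards [hSμ, hF] with x hx hFx using tendsto_supConv hC hx hFx

/-- The semicontinuous half: fix a continuous majorant whose `μ`-integral is close to that of `F`,
and apply weak convergence to the majorant. -/
lemma eventually_integral_lt_of_ae_continuousWithinAt {ι : Type*} {l : Filter ι}
    {μs : ι → ProbabilityMeasure X} {μ : ProbabilityMeasure X} (h : Tendsto μs l (𝓝 μ))
    (hS : ∀ i, ∀ᵐ x ∂(μs i : Measure X), x ∈ S) (hSμ : ∀ᵐ x ∂(μ : Measure X), x ∈ S)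
    (hC : ∀ x, |F x| ≤ C) (hF : ∀ᵐ x ∂(μ : Measure X), ContinuousWithinAt F S x)
    (hm : ∀ i, AEStronglyMeasurable F (μs i : Measure X)) {η : ℝ} (hη : 0 < η) :
    ∀ᶠ i in l, ∫ x, F x ∂(μs i : Measure X) < ∫ x, F x ∂(μ : Measure X) + η := by
  have : Nonempty S := hSμ.exists.elim fun x hx => ⟨⟨x, hx⟩⟩
  have hlim : Tendsto (fun k => ∫ x, supConv F S C k x ∂(μ : Measure X)) atTop
      (𝓝 (∫ x, F x ∂(μ : Measure X))) := by
    refine tendsto_integral_of_dominated_convergence (fun _ => C)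
      (fun k => (continuous_supConv hC k).measurable.aestronglyMeasurable) (by fun_prop)
      (fun k => Eventually.of_forall fun x => ?_) ?_
    · exact abs_supConv_le hC k x
    · filter_upwards [hSμ, hF] with x hx hFx using tendsto_supConv hC hx hFx
  obtain ⟨k, hk⟩ := (hlim.eventually_lt_const
    (show ∫ x, F x ∂(μ : Measure X) < ∫ x, F x ∂(μ : Measure X) + η / 2 by linarith)).exists
  have hconv := ProbabilityMeasure.tendsto_iff_forall_integral_tendsto.1 h
    (BoundedContinuousFunction.ofNormedAddCommGroup (supConv F S C k)
      (continuous_supConv hC k) C (abs_supConv_le hC k))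
  simp only [BoundedContinuousFunction.coe_ofNormedAddCommGroup] at hconv
  filter_upwards [hconv.eventually_lt_const
    (show _ < ∫ x, supConv F S C k x ∂(μ : Measure X) + η / 2 by linarith)] with i hi
  have : ∫ x, F x ∂(μs i : Measure X) ≤ ∫ x, supConv F S C k x ∂(μs i : Measure X) := by
    refine integral_mono_ae (Integrable.of_bound (hm i) C (Eventually.of_forall hC))
      (Integrable.of_bound (continuous_supConv hC k).measurable.aestronglyMeasurable C
        (Eventually.of_forall (abs_supConv_le hC k))) ?_
    filter_upwards [hS i] with x hx using le_supConv hC k hx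
  linarith

/-- Continuous mapping theorem for integrals: if `μs i → μ` weakly, all these measures are carried
by `S`, and `F` is bounded with restriction to `S` continuous at `μ`-almost every point, then the
integrals of `F` converge. -/
lemma tendsto_integral_of_ae_continuousWithinAt {ι : Type*} {l : Filter ι}
    {μs : ι → ProbabilityMeasure X} {μ : ProbabilityMeasure X} (h : Tendsto μs l (𝓝 μ))
    (hS : ∀ i, ∀ᵐ x ∂(μs i : Measure X), x ∈ S) (hSμ : ∀ᵐ x ∂(μ : Measure X), x ∈ S)
    (hC : ∀ x, |F x| ≤ C) (hF : ∀ᵐ x ∂(μ : Measure X), ContinuousWithinAt F S x)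
    (hm : ∀ i, AEStronglyMeasurable F (μs i : Measure X)) :
    Tendsto (fun i => ∫ x, F x ∂(μs i : Measure X)) l (𝓝 (∫ x, F x ∂(μ : Measure X))) := by
  rw [Metric.tendsto_nhds]
  intro η hη
  -- The lower bound is the upper bound for `-F`.
  have h2 := eventually_integral_lt_of_ae_continuousWithinAt h hS hSμ (F := fun x => -F x)
    (C := C) (fun x => by simpa using hC x) (hF.mono fun x hx => hx.neg) (fun i => (hm i).neg) hη
  filter_upwards [eventually_integral_lt_of_ae_continuousWithinAt h hS hSμ hC hF hm hη, h2]
    with i h1 h2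
  rw [integral_neg, integral_neg] at h2
  rw [Real.dist_eq, abs_lt]
  constructor <;> linarith

/-- A weak limit of probability measures carried by a closed set is carried by it. -/
lemma ae_mem_of_tendsto {ι : Type*} {l : Filter ι} [l.NeBot]
    {μs : ι → ProbabilityMeasure X} {μ : ProbabilityMeasure X} (h : Tendsto μs l (𝓝 μ))
    (hSc : IsClosed S) (hS : ∀ i, ∀ᵐ x ∂(μs i : Measure X), x ∈ S) :
    ∀ᵐ x ∂(μ : Measure X), x ∈ S := by
  have h1 := ProbabilityMeasure.limsup_measure_closed_le_of_tendsto h hSc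
  have h2 : ∀ i, (μs i : Measure X) S = 1 := fun i =>
    (prob_compl_eq_zero_iff hSc.measurableSet).1 (hS i)
  simp only [h2, limsup_const] at h1
  exact (prob_compl_eq_zero_iff hSc.measurableSet).2 (le_antisymm prob_le_one h1)

end AlmostEverywhereContinuous

/-! ### Empirical measures. -/

section Empirical

variable {J : Type*} [Fintype J] [Nonempty J]

lemma toMeasure_empirical {X : Type*} [MeasurableSpace X] (y : J → X) :
    (empirical y : Measure X) = ∑ j, (Fintype.card J : ℝ≥0∞)⁻¹ • Measure.dirac (y j) := rfl

lemma integrable_empirical {X : Type*} [MeasurableSpace X] [MeasurableSingletonClass X]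
    (y : J → X) (F : X → ℝ) : Integrable F (empirical y : Measure X) := by
  rw [toMeasure_empirical, integrable_finsetSum_measure]
  intro j _
  refine Integrable.smul_measure (integrable_dirac (by simp)) ?_
  simp

lemma integral_empirical {X : Type*} [MeasurableSpace X] [MeasurableSingletonClass X]
    (y : J → X) (F : X → ℝ) :
    ∫ x, F x ∂(empirical y : Measure X) = (Fintype.card J : ℝ)⁻¹ * ∑ j, F (y j) := by
  rw [toMeasure_empirical, integral_finsetSum_measure]
  · simp [integral_smul_measure, Finset.mul_sum]
  · intro j _
    refine Integrable.smul_measure (integrable_dirac (by simp)) ?_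
    simp

lemma ae_empirical {X : Type*} [MeasurableSpace X] [MeasurableSingletonClass X]
    {y : J → X} {p : X → Prop} (h : ∀ j, p (y j)) :
    ∀ᵐ x ∂(empirical y : Measure X), p x := by
  rw [toMeasure_empirical, ae_iff, Measure.finsetSum_apply]
  refine Finset.sum_eq_zero fun j _ => ?_
  simp [Measure.dirac_apply, h j]

lemma continuous_empirical {X : Type*} [TopologicalSpace X] [T1Space X] [MeasurableSpace X]
    [BorelSpace X] : Continuous (empirical : (J → X) → ProbabilityMeasure X) := by
  rw [continuous_iff_continuousAt]
  intro y
  refine ProbabilityMeasure.tendsto_iff_forall_integral_tendsto.2 fun f => ?_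
  simp only [integral_empirical]
  have : Continuous fun z : J → X => (Fintype.card J : ℝ)⁻¹ * ∑ j, f (z j) := by fun_prop
  exact this.tendsto y

-- A unilateral deviation moves a single atom, of mass `1 / |J|`.
open Classical in
lemma abs_integral_empirical_update_sub_le {X : Type*} [TopologicalSpace X] [T1Space X]
    [MeasurableSpace X] [BorelSpace X] (f : X →ᵇ ℝ) (y : J → X) (i : J) (a : X) :
    |∫ x, f x ∂(empirical (Function.update y i a) : Measure X) -
      ∫ x, f x ∂(empirical y : Measure X)| ≤ (Fintype.card J : ℝ)⁻¹ * (2 * ‖f‖) := by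
  rw [integral_empirical, integral_empirical, ← mul_sub, abs_mul, abs_of_nonneg (by positivity)]
  gcongr
  rw [← Finset.sum_sub_distrib, Finset.sum_eq_single i]
  · rw [← Real.dist_eq]
    exact f.dist_le_two_norm _ _
  · intro j _ hj
    simp [Function.update_of_ne hj]
  · simp

end Empirical

/-! ### Pure profiles in finite games. -/

section PureProfiles

variable {J : Type*} [Fintype J] [Nonempty J] {A : Type*} [MetricSpace A] [CompactSpace A]
  [MeasurableSpace A] [BorelSpace A]

-- A product of Dirac masses with the `i`-th factor replaced by `μ` is the image of `μ` under `a ↦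
-- Function.update f i a`; this is checked on boxes.
open Classical in
lemma expectedPayoff_update_dirac (u : Payoff A) (f : J → A) (i : J) (μ : ProbabilityMeasure A) :
    expectedPayoff u (Function.update (fun j => diracProba (f j)) i μ) i =
      ∫ a, u (a, empirical (Function.update f i a)) ∂(μ : Measure A) := by
  have hpi : (Measure.pi fun j =>
      ((Function.update (fun j => diracProba (f j)) i μ j : ProbabilityMeasure A) : Measure A)) =
      (μ : Measure A).map fun a => Function.update f i a := by
    refine Measure.pi_eq fun s hs => ?_
    have hupd : Measurable fun a => Function.update f i a := measurable_update f
    rw [Measure.map_apply hupd (MeasurableSet.univ_pi hs),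
      ← Finset.mul_prod_erase Finset.univ _ (Finset.mem_univ i)]
    have hprod : ∏ j ∈ Finset.univ.erase i,
        ((Function.update (fun j => diracProba (f j)) i μ j : ProbabilityMeasure A) :
          Measure A) (s j) = ∏ j ∈ Finset.univ.erase i, (s j).indicator 1 (f j) := by
      refine Finset.prod_congr rfl fun j hj => ?_
      rw [Function.update_of_ne (Finset.ne_of_mem_erase hj), diracProba_toMeasure_apply]
    rw [hprod, Function.update_self]
    by_cases h : ∀ j ∈ Finset.univ.erase i, f j ∈ s j
    · rw [Finset.prod_eq_one fun j hj => Set.indicator_of_mem (h j hj) _, mul_one]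
      congr 1
      ext a
      simp only [Set.mem_preimage, Set.mem_univ_pi]
      refine ⟨fun H => by simpa using H i, fun ha j => ?_⟩
      by_cases hj : j = i
      · subst hj; simpa using ha
      · simpa [Function.update_of_ne hj] using h j (by simp [hj])
    · push Not at h
      obtain ⟨j, hj, hfj⟩ := h
      rw [Finset.prod_eq_zero hj (Set.indicator_of_notMem hfj _), mul_zero]
      convert measure_empty
      · ext a
        simp only [Set.mem_preimage, Set.mem_univ_pi, Set.mem_empty_iff_false, iff_false]
        intro H
        have := H j
        rw [Function.update_of_ne (Finset.ne_of_mem_erase hj)] at this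
        exact hfj this
      · infer_instance
  rw [expectedPayoff, hpi, integral_map]
  · simp
  · exact (measurable_update f).aemeasurable
  · have : Continuous fun a : J → A => u (a i, empirical a) :=
      u.continuous.comp ((continuous_apply i).prodMk continuous_empirical)
    exact this.aestronglyMeasurable

open Classical in
lemma expectedPayoff_dirac (u : Payoff A) (f : J → A) (i : J) :
    expectedPayoff u (fun j => diracProba (f j)) i = u (f i, empirical f) := by
  have h := expectedPayoff_update_dirac u f i (diracProba (f i))
  rw [Function.update_eq_self i (fun j => diracProba (f j))] at h
  rw [h]
  simp [diracProba]

open Classical in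
/-- In a pure strategy profile it suffices to test pure deviations. -/
lemma isPureEpsNash_iff (u : J → Payoff A) (ε : ℝ) (f : J → A) :
    IsPureEpsNash u ε f ↔
      ∃ S : Finset J, 1 - ε ≤ (S.card : ℝ) / (Fintype.card J : ℝ) ∧
        ∀ i ∈ S, ∀ a, u i (a, empirical (Function.update f i a)) - ε ≤ u i (f i, empirical f) := by
  unfold IsPureEpsNash IsEpsNash
  refine exists_congr fun S => and_congr_right fun _ => forall₂_congr fun i _ => ?_
  simp only [expectedPayoff_update_dirac, expectedPayoff_dirac]
  refine ⟨fun h a => ?_, fun h μ => ?_⟩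
  · simpa [diracProba] using h (diracProba a)
  · have hle : ∫ a, u i (a, empirical (Function.update f i a)) ∂(μ : Measure A) ≤
        ∫ _, (u i (f i, empirical f) + ε) ∂(μ : Measure A) := by
      have hcont : Continuous fun a => u i (a, empirical (Function.update f i a)) :=
        (u i).continuous.comp (continuous_id.prodMk
          (continuous_empirical.comp (continuous_const.update i continuous_id)))
      refine integral_mono (Integrable.of_bound hcont.aestronglyMeasurable ‖u i‖
        (Eventually.of_forall fun a => (u i).norm_coe_le_norm _)) (integrable_const _) fun a => ?_
      have := h a
      simp only
      linarith
    simp only [integral_const, probReal_univ, one_smul] at hle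
    linarith

-- This yields the measurability of the events: closedness survives the possibly uncountable
-- intersection over deviations `a`, and the union over `S` is finite.
open Classical in
lemma isClosed_setOf_isPureEpsNash (u : J → Payoff A) (ε : ℝ) :
    IsClosed {f : J → A | IsPureEpsNash u ε f} := by
  simp only [isPureEpsNash_iff, Set.ofPred_exists, Set.ofPred_and, Set.ofPred_forall]
  refine isClosed_iUnion_of_finite fun S => isClosed_const.inter ?_
  refine isClosed_biInter fun i _ => isClosed_iInter fun a => isClosed_le ?_ ?_
  · exact ((u i).continuous.comp (continuous_const.prodMk
      (continuous_empirical.comp (continuous_id.update i continuous_const)))).sub continuous_const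
  · exact (u i).continuous.comp ((continuous_apply i).prodMk continuous_empirical)

open Classical in
/-- A profile is a pure-strategy `ε`-Nash equilibrium if, on average over the players, the loss
`r` of each player against `τ` and the effect `o` of perturbations of `τ` are small. -/
lemma isPureEpsNash_of_mean_lt {u : J → Payoff A} {ε δ : ℝ} (hε : 3 * δ ≤ ε) (hδ : 0 < δ)
    {f : J → A} {r o : J → ℝ} {U : Set (ProbabilityMeasure A)} {τ : ProbabilityMeasure A}
    (hr0 : ∀ i, 0 ≤ r i) (ho0 : ∀ i, 0 ≤ o i)
    (hr : ∀ i, r i < δ → ∀ a, u i (a, τ) ≤ u i (f i, τ) + δ)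
    (ho : ∀ i, o i < δ → ∀ a, ∀ ν ∈ U, |u i (a, ν) - u i (a, τ)| ≤ δ)
    (hU : empirical f ∈ U)
    (hU' : ∀ i a, empirical (Function.update f i a) ∈ U)
    (hmean : (Fintype.card J : ℝ)⁻¹ * ∑ i, r i + (Fintype.card J : ℝ)⁻¹ * ∑ i, o i ≤ δ * ε) :
    IsPureEpsNash u ε f := by
  rw [isPureEpsNash_iff]
  have hJ : (0 : ℝ) < Fintype.card J := by exact_mod_cast Fintype.card_pos
  refine ⟨Finset.univ.filter fun i => r i + o i < δ, ?_, fun i hi a => ?_⟩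
  · have hsplit := Finset.card_filter_add_card_filter_not (s := (Finset.univ : Finset J))
      (fun i => r i + o i < δ)
    -- Markov's inequality for counting measure: each player in `B` contributes at least `δ` to a
    -- sum of at most `|J| * δ * ε`.
    set B := Finset.univ.filter fun i => ¬ (r i + o i < δ) with hB
    have hBsum : B.card * δ ≤ ∑ i, (r i + o i) := by
      calc B.card * δ = ∑ i ∈ B, δ := by simp
        _ ≤ ∑ i ∈ B, (r i + o i) := Finset.sum_le_sum fun i hi => by
            simpa [hB] using hi
        _ ≤ ∑ i, (r i + o i) := Finset.sum_le_sum_of_subset_of_nonneg (Finset.subset_univ _)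
            fun i _ _ => add_nonneg (hr0 i) (ho0 i)
    rw [← mul_add, ← Finset.sum_add_distrib, inv_mul_le_iff₀ hJ] at hmean
    have hBcard : (B.card : ℝ) ≤ Fintype.card J * ε := by
      have : B.card * δ ≤ (Fintype.card J * ε) * δ := by linarith
      exact le_of_mul_le_mul_right this hδ
    have hsplit' : ((Finset.univ.filter fun i => r i + o i < δ).card : ℝ) + B.card =
        Fintype.card J := by
      rw [← Finset.card_univ]
      exact_mod_cast hsplit
    rw [le_div_iff₀ hJ]
    linarith
  · have hi : r i + o i < δ := by simpa using hi
    have h1 := hr i (by linarith [ho0 i]) a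
    have h2 := ho i (by linarith [hr0 i])
    -- The three `δ`: regret at `τ`, and replacing `τ` by the actual distribution once for the
    -- deviation and once for `f i`.
    have h3 := (abs_le.1 (h2 a _ (hU' i a))).2
    have h4 := (abs_le.1 (h2 (f i) _ hU)).1
    linarith

end PureProfiles

/-! ### Oscillation and regret as functionals of the payoff. -/

section Functionals

variable {A : Type*} [MetricSpace A] [MeasurableSpace A] [BorelSpace A]

lemma bddAbove_payoff (u : Payoff A) (τ : ProbabilityMeasure A) :
    BddAbove (Set.range fun b => u (b, τ)) := by
  refine ⟨‖u‖, ?_⟩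
  rintro _ ⟨b, rfl⟩
  exact (le_abs_self _).trans (u.norm_coe_le_norm _)

/-- The largest effect, truncated at `1`, on the payoff `u` of a change of the action distribution
from `τ` to an element of `U`. -/
noncomputable def oscillation (τ : ProbabilityMeasure A) (U : Set (ProbabilityMeasure A))
    (u : Payoff A) : ℝ :=
  min 1 (⨆ p : A × U, |u (p.1, p.2) - u (p.1, τ)|)

lemma bddAbove_abs_sub (τ : ProbabilityMeasure A) (U : Set (ProbabilityMeasure A))
    (u : Payoff A) : BddAbove (Set.range fun p : A × U => |u (p.1, p.2) - u (p.1, τ)|) := by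
  refine ⟨2 * ‖u‖, ?_⟩
  rintro _ ⟨p, rfl⟩
  exact u.dist_le_two_norm _ _

lemma oscillation_nonneg (τ : ProbabilityMeasure A) (U : Set (ProbabilityMeasure A))
    (u : Payoff A) : 0 ≤ oscillation τ U u :=
  le_min zero_le_one (Real.iSup_nonneg fun _ => abs_nonneg _)

lemma oscillation_le_one (τ : ProbabilityMeasure A) (U : Set (ProbabilityMeasure A))
    (u : Payoff A) : oscillation τ U u ≤ 1 := min_le_left _ _

lemma ciSup_payoff_le [Nonempty A] (u w : Payoff A) (τ : ProbabilityMeasure A) :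
    ⨆ b, u (b, τ) ≤ (⨆ b, w (b, τ)) + dist u w := by
  refine ciSup_le fun b => ?_
  have h1 := le_ciSup (bddAbove_payoff w τ) b
  have h2 := (abs_le.1 (u.dist_coe_le_dist (g := w) (b, τ))).2
  linarith

lemma abs_oscillation_le_one (τ : ProbabilityMeasure A) (U : Set (ProbabilityMeasure A))
    (u : Payoff A) : |oscillation τ U u| ≤ 1 := by
  rw [abs_of_nonneg (oscillation_nonneg τ U u)]
  exact oscillation_le_one τ U u

lemma abs_sub_le_of_oscillation_lt {τ : ProbabilityMeasure A} {U : Set (ProbabilityMeasure A)}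
    {u : Payoff A} {δ : ℝ} (hδ : δ ≤ 1) (h : oscillation τ U u < δ) (a : A)
    {ν : ProbabilityMeasure A} (hν : ν ∈ U) : |u (a, ν) - u (a, τ)| ≤ δ := by
  have h1 := le_ciSup (bddAbove_abs_sub τ U u) (a, ⟨ν, hν⟩)
  rw [oscillation, min_lt_iff] at h
  rcases h with h | h
  · linarith
  · exact h1.trans h.le

lemma continuous_oscillation (τ : ProbabilityMeasure A) (U : Set (ProbabilityMeasure A)) :
    Continuous (oscillation τ U) := by
  refine continuous_const.min ?_
  refine (LipschitzWith.of_le_add_mul 2 fun u w => Real.iSup_le (fun p => ?_) ?_).continuous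
  · have h1 := le_ciSup (bddAbove_abs_sub τ U w) p
    have h2 := u.dist_coe_le_dist (g := w) (p.1, (p.2 : ProbabilityMeasure A))
    have h3 := u.dist_coe_le_dist (g := w) (p.1, τ)
    rw [dist_comm, Real.dist_eq] at h3
    rw [Real.dist_eq] at h2
    have h4 := abs_add_three (u (p.1, (p.2 : ProbabilityMeasure A)) - w (p.1, p.2))
      (w (p.1, p.2) - w (p.1, τ)) (w (p.1, τ) - u (p.1, τ))
    have h5 : u (p.1, (p.2 : ProbabilityMeasure A)) - w (p.1, p.2) + (w (p.1, p.2) - w (p.1, τ)) +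
      (w (p.1, τ) - u (p.1, τ)) = u (p.1, (p.2 : ProbabilityMeasure A)) - u (p.1, τ) := by ring
    rw [h5] at h4
    simp only [NNReal.coe_ofNat] at h1 ⊢
    linarith
  · have := Real.iSup_nonneg fun p : A × U => abs_nonneg (w (p.1, p.2) - w (p.1, τ))
    positivity

/-- The pairing of bounded continuous functions with probability measures is jointly
continuous. -/
lemma tendsto_integral_of_tendsto {ι X : Type*} [TopologicalSpace X] [MeasurableSpace X]
    [OpensMeasurableSpace X] {l : Filter ι} {φ : ι → X →ᵇ ℝ} {φ₀ : X →ᵇ ℝ}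
    {ν : ι → ProbabilityMeasure X} {ν₀ : ProbabilityMeasure X} (hφ : Tendsto φ l (𝓝 φ₀))
    (hν : Tendsto ν l (𝓝 ν₀)) :
    Tendsto (fun i => ∫ a, φ i a ∂(ν i : Measure X)) l (𝓝 (∫ a, φ₀ a ∂(ν₀ : Measure X))) := by
  have h1 := ProbabilityMeasure.tendsto_iff_forall_integral_tendsto.1 hν φ₀
  have h2 : Tendsto (fun i => ∫ a, φ i a ∂(ν i : Measure X) - ∫ a, φ₀ a ∂(ν i : Measure X)) l
      (𝓝 0) := by
    refine squeeze_zero_norm (fun i => ?_) (tendsto_iff_dist_tendsto_zero.1 hφ)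
    rw [← integral_sub ((φ i).integrable _) (φ₀.integrable _)]
    refine (norm_integral_le_of_norm_le_const (C := dist (φ i) φ₀)
      (Eventually.of_forall fun a => ?_)).trans_eq (by simp)
    exact (φ i).dist_coe_le_dist a
  simpa using h2.add h1

variable [CompactSpace A]

/-- The loss, truncated at `1`, from playing `a` instead of a best response to `τ`. -/
noncomputable def regret (τ : ProbabilityMeasure A) (u : Payoff A) : A →ᵇ ℝ :=
  BoundedContinuousFunction.mkOfCompact
    ⟨fun a => min 1 ((⨆ b, u (b, τ)) - u (a, τ)), by fun_prop⟩

lemma regret_apply (τ : ProbabilityMeasure A) (u : Payoff A) (a : A) :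
    regret τ u a = min 1 ((⨆ b, u (b, τ)) - u (a, τ)) := rfl

lemma regret_nonneg (τ : ProbabilityMeasure A) (u : Payoff A) (a : A) : 0 ≤ regret τ u a :=
  le_min zero_le_one (sub_nonneg.2 (le_ciSup (bddAbove_payoff u τ) a))

lemma regret_le_one (τ : ProbabilityMeasure A) (u : Payoff A) (a : A) : regret τ u a ≤ 1 :=
  min_le_left _ _

lemma le_add_of_regret_lt {τ : ProbabilityMeasure A} {u : Payoff A} {a : A} {δ : ℝ} (hδ : δ ≤ 1)
    (h : regret τ u a < δ) (b : A) : u (b, τ) ≤ u (a, τ) + δ := by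
  have h1 := le_ciSup (bddAbove_payoff u τ) b
  rw [regret_apply, min_lt_iff] at h
  rcases h with h | h <;> linarith

/-- Continuity in sup norm is what lets `regret τ u` be paired with the varying measure `gbar u`.
The supremum and the evaluation each move by at most `dist u w`, hence the constant `2`. -/
lemma continuous_regret [Nonempty A] (τ : ProbabilityMeasure A) :
    Continuous (regret τ : Payoff A → A →ᵇ ℝ) := by
  refine (LipschitzWith.of_dist_le_mul (K := 2) fun u w => ?_).continuous
  refine (BoundedContinuousFunction.dist_le (by positivity)).2 fun a => ?_
  rw [regret_apply, regret_apply, Real.dist_eq]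
  refine (abs_min_sub_min_le_max _ _ _ _).trans ?_
  have h1 := ciSup_payoff_le u w τ
  have h2 := ciSup_payoff_le w u τ
  rw [dist_comm] at h2
  have h3 := abs_le.1 (u.dist_coe_le_dist (g := w) (a, τ))
  simp only [sub_self, abs_zero, NNReal.coe_ofNat]
  refine max_le (by positivity) (abs_le.2 ⟨?_, ?_⟩) <;> linarith [h3.1, h3.2]

/-- Tube lemma: compactness of `A` makes continuity at `τ` uniform in the action. -/
lemma eventually_oscillation_le (τ : ProbabilityMeasure A) (u : Payoff A) {η : ℝ} (hη : 0 < η) :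
    ∀ᶠ U in (𝓝 τ).smallSets, oscillation τ U u ≤ η := by
  have h : ∀ᶠ ν in 𝓝 τ, ∀ a ∈ (Set.univ : Set A), |u (a, ν) - u (a, τ)| < η := by
    refine isCompact_univ.eventually_forall_of_forall_eventually fun a _ => ?_
    have hc : Continuous fun p : ProbabilityMeasure A × A => |u (p.2, p.1) - u (p.2, τ)| := by
      fun_prop
    exact hc.continuousAt.eventually_lt continuousAt_const (by simpa using hη)
  filter_upwards [eventually_smallSets_forall.2 h] with U hU
  exact min_le_of_right_le (Real.iSup_le (fun p => (hU p.2 p.2.2 p.1 trivial).le) hη.le)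

/-- On average with respect to a given distribution of characteristics, the effect of a
sufficiently small change of the action distribution is small. -/
lemma exists_mem_nhds_integral_oscillation_lt (τ : ProbabilityMeasure A)
    (μ : ProbabilityMeasure (Payoff A)) {η : ℝ} (hη : 0 < η) :
    ∃ U ∈ 𝓝 τ, ∫ u, oscillation τ U u ∂(μ : Measure (Payoff A)) < η := by
  -- A countable basis allows dominated convergence along a sequence of shrinking neighbourhoods.
  obtain ⟨U, hU⟩ := (𝓝 τ).exists_antitone_basis
  have hlim : Tendsto (fun k => ∫ u, oscillation τ (U k) u ∂(μ : Measure (Payoff A))) atTop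
      (𝓝 (∫ _, (0 : ℝ) ∂(μ : Measure (Payoff A)))) := by
    refine tendsto_integral_of_dominated_convergence (fun _ => 1)
      (fun k => (continuous_oscillation τ (U k)).measurable.aestronglyMeasurable)
      (integrable_const _)
      (fun k => Eventually.of_forall fun u => abs_oscillation_le_one τ (U k) u)
      (Eventually.of_forall fun u => ?_)
    rw [Metric.tendsto_nhds]
    intro δ hδ
    filter_upwards [hU.tendsto_smallSets.eventually
      (eventually_oscillation_le τ u (half_pos hδ))] with k hk
    rw [dist_zero_right, Real.norm_of_nonneg (oscillation_nonneg _ _ _)]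
    linarith
  rw [integral_zero] at hlim
  obtain ⟨k, hk⟩ := (hlim.eventually_lt_const hη).exists
  exact ⟨U k, hU.mem k, hk⟩

end Functionals

/-! ### Law of large numbers for empirical action distributions. -/

section LawOfLargeNumbers

/-- Chebyshev's inequality for the mean of uniformly bounded, pairwise independent random
variables. -/
lemma measure_le_abs_mean_sub_le {Ω J : Type*} [MeasurableSpace Ω] (Pr : Measure Ω)
    [IsProbabilityMeasure Pr] [Fintype J] [Nonempty J] {X : J → Ω → ℝ} {C : ℝ}
    (hX : ∀ i, Measurable (X i)) (hC : ∀ i ω, |X i ω| ≤ C)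
    (hindep : Pairwise fun i j => IndepFun (X i) (X j) Pr) {c : ℝ} (hc : 0 < c) :
    Pr {ω | c ≤ |(Fintype.card J : ℝ)⁻¹ * ∑ i, X i ω -
        (Fintype.card J : ℝ)⁻¹ * ∑ i, ∫ ω, X i ω ∂Pr|} ≤
      ENNReal.ofReal (C ^ 2 / c ^ 2 * (Fintype.card J : ℝ)⁻¹) := by
  have hJ : (0 : ℝ) < Fintype.card J := by exact_mod_cast Fintype.card_pos
  have hmem : ∀ i, MemLp (X i) 2 Pr := fun i =>
    MemLp.of_bound (hX i).aestronglyMeasurable C (Eventually.of_forall (hC i))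
  have hvar : variance (∑ i, X i) Pr ≤ Fintype.card J * C ^ 2 := by
    rw [IndepFun.variance_sum (fun i _ => hmem i) fun i _ j _ hij => hindep hij]
    calc ∑ i, variance (X i) Pr ≤ ∑ _i : J, C ^ 2 := Finset.sum_le_sum fun i _ => by
          have := variance_le_sq_of_bounded (μ := Pr) (X := X i) (a := -C) (b := C)
            (Eventually.of_forall fun ω => ⟨(abs_le.1 (hC i ω)).1, (abs_le.1 (hC i ω)).2⟩)
            (hX i).aemeasurable
          calc _ ≤ _ := this
            _ = C ^ 2 := by ring
      _ = Fintype.card J * C ^ 2 := by simp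
  have hcheb := meas_ge_le_variance_div_sq (μ := Pr) (X := ∑ i, X i)
    (memLp_finsetSum' _ fun i _ => hmem i) (mul_pos hJ hc)
  have hint : ∫ ω, (∑ i, X i) ω ∂Pr = ∑ i, ∫ ω, X i ω ∂Pr := by
    simp only [Finset.sum_apply]
    exact integral_finsetSum _ fun i _ => (hmem i).integrable one_le_two
  rw [hint] at hcheb
  refine le_trans (measure_mono fun ω hω => ?_) (hcheb.trans (ENNReal.ofReal_le_ofReal ?_))
  · simp only [Set.mem_ofPred_eq, ← mul_sub, abs_mul, abs_inv, abs_of_pos hJ] at hω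
    simp only [Set.mem_ofPred_eq, Finset.sum_apply]
    exact (le_inv_mul_iff₀ hJ).1 hω
  · rw [div_le_iff₀ (by positivity)]
    refine hvar.trans_eq ?_
    field_simp

/-- The filter of the sets that contain the random sets `Z i` with probability tending to `1`. -/
def containsInProbability {Ω ι Y : Type*} [MeasurableSpace Ω] (Pr : Measure Ω) (l : Filter ι)
    (Z : ι → Ω → Set Y) : Filter Y where
  sets := {U | Tendsto (fun i => Pr {ω | ¬ Z i ω ⊆ U}) l (𝓝 0)}
  univ_sets := by simpa using tendsto_const_nhds
  sets_of_superset := fun {U V} hU hUV =>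
    tendsto_of_tendsto_of_tendsto_of_le_of_le tendsto_const_nhds hU (fun _ => zero_le)
      fun i => measure_mono fun ω hω h => hω (h.trans hUV)
  inter_sets := fun {U V} hU hV => by
    have h := Tendsto.add hU hV
    rw [add_zero] at h
    refine tendsto_of_tendsto_of_tendsto_of_le_of_le tendsto_const_nhds h (fun _ => zero_le)
      fun i => (measure_mono fun ω hω => ?_).trans (measure_union_le _ _)
    simp only [Set.subset_inter_iff, not_and_or, Set.mem_ofPred_eq] at hω
    exact hω

lemma mem_containsInProbability {Ω ι Y : Type*} [MeasurableSpace Ω] {Pr : Measure Ω}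
    {l : Filter ι} {Z : ι → Ω → Set Y} {U : Set Y} :
    U ∈ containsInProbability Pr l Z ↔ Tendsto (fun i => Pr {ω | ¬ Z i ω ⊆ U}) l (𝓝 0) := Iff.rfl

open Classical in
/-- The action distributions `empirical y` and those after a unilateral deviation. -/
noncomputable def deviationDists {J : Type*} [Fintype J] [Nonempty J] {A : Type*}
    [MeasurableSpace A] (y : J → A) : Set (ProbabilityMeasure A) :=
  insert (empirical y) (Set.range fun p : J × A => empirical (Function.update y p.1 p.2))

variable {A : Type*} [MetricSpace A] [MeasurableSpace A] [BorelSpace A]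

lemma abs_integral_sub_le_of_mem_deviationDists {J : Type*} [Fintype J] [Nonempty J] {y : J → A}
    {ν : ProbabilityMeasure A} (hν : ν ∈ deviationDists y) (f : A →ᵇ ℝ) :
    |∫ a, f a ∂(ν : Measure A) - ∫ a, f a ∂(empirical y : Measure A)| ≤
      (Fintype.card J : ℝ)⁻¹ * (2 * ‖f‖) := by
  rcases hν with rfl | ⟨p, rfl⟩
  · simp only [sub_self, abs_zero]
    positivity
  · exact abs_integral_empirical_update_sub_le f y p.1 p.2

/-- Law of large numbers for the action distributions of pairwise independent actions, uniformly
over unilateral deviations. -/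
lemma tendsto_measure_not_deviationDists_subset {Ω ι : Type*} [MeasurableSpace Ω] (Pr : Measure Ω)
    [IsProbabilityMeasure Pr] {l : Filter ι} {P : ι → Type*} [∀ n, Fintype (P n)]
    [∀ n, Nonempty (P n)] (hcard : Tendsto (fun n => (Fintype.card (P n) : ℝ)⁻¹) l (𝓝 0))
    {x : ∀ n, P n → Ω → A} (hx : ∀ n i, Measurable (x n i))
    (hindep : ∀ n, Pairwise fun i j => IndepFun (x n i) (x n j) Pr) {τ : ProbabilityMeasure A}
    (hmean : ∀ f : A →ᵇ ℝ, Tendsto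
      (fun n => (Fintype.card (P n) : ℝ)⁻¹ * ∑ i, ∫ ω, f (x n i ω) ∂Pr) l
      (𝓝 (∫ a, f a ∂(τ : Measure A)))) {U : Set (ProbabilityMeasure A)} (hU : U ∈ 𝓝 τ) :
    Tendsto (fun n => Pr {ω | ¬ deviationDists (fun i => x n i ω) ⊆ U}) l (𝓝 0) := by
  rw [← mem_containsInProbability]
  -- Stated as convergence of a filter on `ProbabilityMeasure A`, the claim reduces to one test
  -- function at a time; the filter axioms absorb the finite intersections in a weak neighbourhood.
  suffices h : Tendsto id (containsInProbability Pr l fun n ω => deviationDists fun i => x n i ω)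
    (𝓝 τ) from h hU
  refine ProbabilityMeasure.tendsto_iff_forall_integral_tendsto.2 fun f => ?_
  refine Metric.tendsto_nhds.2 fun η hη => ?_
  rw [Filter.Eventually, mem_containsInProbability]
  have hbound : Tendsto (fun n => ENNReal.ofReal
      (‖f‖ ^ 2 / (η / 3) ^ 2 * (Fintype.card (P n) : ℝ)⁻¹)) l (𝓝 0) := by
    have := ENNReal.tendsto_ofReal (hcard.const_mul (‖f‖ ^ 2 / (η / 3) ^ 2))
    simpa using this
  refine tendsto_of_tendsto_of_tendsto_of_le_of_le' tendsto_const_nhds hbound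
    (Eventually.of_forall fun _ => zero_le) ?_
  have hdev : Tendsto (fun n => (Fintype.card (P n) : ℝ)⁻¹ * (2 * ‖f‖)) l (𝓝 0) := by
    simpa using hcard.mul_const (2 * ‖f‖)
  -- `η` is split between the deviation, the bias of the mean and the random fluctuation.
  filter_upwards [hdev.eventually_lt_const (by positivity : 0 < η / 3),
    Metric.tendsto_nhds.1 (hmean f) (η / 3) (by positivity)] with n hn1 hn2
  refine le_trans (measure_mono fun ω hω => ?_)
    (measure_le_abs_mean_sub_le Pr (X := fun i ω => f (x n i ω)) (C := ‖f‖) (c := η / 3)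
      (fun i => f.continuous.measurable.comp (hx n i)) (fun i ω => f.norm_coe_le_norm _)
      (fun i j hij => (hindep n hij).comp f.continuous.measurable f.continuous.measurable)
      (by positivity))
  simp only [Set.mem_ofPred_eq] at hω ⊢
  by_contra hlt
  refine hω fun ν hν => ?_
  have h1 := abs_lt.1 ((abs_integral_sub_le_of_mem_deviationDists hν f).trans_lt hn1)
  rw [integral_empirical] at h1
  rw [Real.dist_eq] at hn2
  have h2 := abs_lt.1 hn2
  have h3 := abs_lt.1 (not_le.1 hlt)
  simp only [id, Set.mem_ofPred_eq, Real.dist_eq]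
  rw [abs_lt]
  constructor <;> linarith [h1.1, h1.2, h2.1, h2.2, h3.1, h3.2]

end LawOfLargeNumbers

/-! ### Transfer from the large game to the direct strategies. -/

section DirectStrategies

variable {A : Type*} [MetricSpace A] [MeasurableSpace A] [BorelSpace A]
  {I : Type*} [MeasurableSpace I] {G : LargeGame I A}

lemma integral_charDist {F : Payoff A → ℝ}
    (hF : AEStronglyMeasurable F (G.charDist : Measure (Payoff A))) :
    ∫ u, F u ∂(G.charDist : Measure (Payoff A)) = ∫ i, F (G.payoff i) ∂(G.lam : Measure I) :=
  integral_map G.measurable_payoff.aemeasurable hF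

lemma integral_societalSummary {lam : ProbabilityMeasure I} {g : I → ProbabilityMeasure A}
    (hg : Measurable g) (f : A →ᵇ ℝ) :
    ∫ a, f a ∂(societalSummary lam g hg : Measure A) =
      ∫ i, ∫ a, f a ∂(g i : Measure A) ∂(lam : Measure I) := by
  -- The summary is the composition of the kernel `κ` with a constant kernel on `Unit`, so the
  -- kernel Fubini formula applies.
  let κ : Kernel I A := ⟨fun i => (g i : Measure A), measurable_subtype_coe.comp hg⟩
  exact Kernel.integral_comp (η := κ) (κ := Kernel.const Unit (lam : Measure I)) (a := ())
    (f.integrable (societalSummary lam g hg : Measure A))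

variable {ι : Type*} {l : Filter ι} {P : ι → Type*} [∀ n, Fintype (P n)] [∀ n, Nonempty (P n)]
  {Gn : ∀ n, P n → Payoff A} {gbar : Payoff A → ProbabilityMeasure A} {S : Set (Payoff A)}

lemma tendsto_mean_of_tendsto_empirical (hS : ∀ n i, Gn n i ∈ S)
    (hSμ : ∀ᵐ u ∂(G.charDist : Measure (Payoff A)), u ∈ S)
    (hconv : Tendsto (fun n => empirical (Gn n)) l (𝓝 G.charDist)) {F : Payoff A → ℝ} {C : ℝ}
    (hC : ∀ u, |F u| ≤ C)
    (hF : ∀ᵐ u ∂(G.charDist : Measure (Payoff A)), ContinuousWithinAt F S u) :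
    Tendsto (fun n => (Fintype.card (P n) : ℝ)⁻¹ * ∑ i, F (Gn n i)) l
      (𝓝 (∫ i, F (G.payoff i) ∂(G.lam : Measure I))) := by
  have h := tendsto_integral_of_ae_continuousWithinAt hconv (fun n => ae_empirical (hS n)) hSμ hC
    hF fun n => (integrable_empirical _ _).aestronglyMeasurable
  rw [integral_charDist (aestronglyMeasurable_of_ae_continuousWithinAt hSμ hC hF)] at h
  simpa only [integral_empirical] using h

/-- The mean expectation of a test function under the direct strategies converges to its integral
against the equilibrium action distribution. -/
lemma tendsto_mean_integral {τ : ProbabilityMeasure A} (hgbar : G.IsAuxiliaryMapping τ gbar)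
    (hS : ∀ n i, Gn n i ∈ S) (hSμ : ∀ᵐ u ∂(G.charDist : Measure (Payoff A)), u ∈ S)
    (hconv : Tendsto (fun n => empirical (Gn n)) l (𝓝 G.charDist))
    (hcont : ∀ᵐ u ∂(G.charDist : Measure (Payoff A)), ContinuousWithinAt gbar S u)
    (f : A →ᵇ ℝ) :
    Tendsto (fun n => (Fintype.card (P n) : ℝ)⁻¹ * ∑ i, ∫ a, f a ∂(gbar (Gn n i) : Measure A)) l
      (𝓝 (∫ a, f a ∂(τ : Measure A))) := by
  obtain ⟨hm, -, rfl⟩ := hgbar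
  rw [integral_societalSummary]
  refine tendsto_mean_of_tendsto_empirical hS hSμ hconv
    (F := fun u => ∫ a, f a ∂(gbar u : Measure A)) (C := ‖f‖)
    (fun u => f.norm_integral_le_norm _) ?_
  filter_upwards [hcont] with u hu
  exact tendsto_integral_of_tendsto tendsto_const_nhds hu

variable [CompactSpace A]

/-- In a Nash equilibrium almost every player has zero expected loss. -/
lemma LargeGame.IsNash.ae_integral_regret_eq_zero {g : I → ProbabilityMeasure A}
    {hg : Measurable g} (h : G.IsNash g hg) :
    ∀ᵐ i ∂(G.lam : Measure I),
      ∫ a, regret (societalSummary G.lam g hg) (G.payoff i) a ∂(g i : Measure A) = 0 := by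
  filter_upwards [h] with i hi
  set τ := societalSummary G.lam g hg
  have : Nonempty A := (g i : Measure A).nonempty_of_neZero
  refine le_antisymm ?_ (integral_nonneg fun a => regret_nonneg _ _ a)
  have hsup : ⨆ b, G.payoff i (b, τ) ≤ ∫ a, G.payoff i (a, τ) ∂(g i : Measure A) :=
    ciSup_le fun b => by simpa [diracProba] using hi (diracProba b)
  have hint : Integrable (fun a => G.payoff i (a, τ)) (g i : Measure A) :=
    ((G.payoff i).compContinuous ⟨fun a => (a, τ), by fun_prop⟩).integrable _
  calc ∫ a, regret τ (G.payoff i) a ∂(g i : Measure A)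
      ≤ ∫ a, ((⨆ b, G.payoff i (b, τ)) - G.payoff i (a, τ)) ∂(g i : Measure A) :=
        integral_mono ((regret τ (G.payoff i)).integrable _) ((integrable_const _).sub hint)
          fun a => min_le_right _ _
    _ ≤ 0 := by
        rw [integral_sub (integrable_const _) hint]
        simpa using hsup

/-- The mean expected loss under the direct strategies tends to zero. -/
lemma tendsto_mean_regret {τ : ProbabilityMeasure A} (hgbar : G.IsAuxiliaryMapping τ gbar)
    (hS : ∀ n i, Gn n i ∈ S) (hSμ : ∀ᵐ u ∂(G.charDist : Measure (Payoff A)), u ∈ S)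
    (hconv : Tendsto (fun n => empirical (Gn n)) l (𝓝 G.charDist))
    (hcont : ∀ᵐ u ∂(G.charDist : Measure (Payoff A)), ContinuousWithinAt gbar S u) :
    Tendsto (fun n => (Fintype.card (P n) : ℝ)⁻¹ *
      ∑ i, ∫ a, regret τ (Gn n i) a ∂(gbar (Gn n i) : Measure A)) l (𝓝 0) := by
  have : Nonempty A := (τ : Measure A).nonempty_of_neZero
  obtain ⟨hm, hNash, rfl⟩ := hgbar
  set τ := societalSummary G.lam (gbar ∘ G.payoff) hm
  have h := tendsto_mean_of_tendsto_empirical hS hSμ hconv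
    (F := fun u => ∫ a, regret τ u a ∂(gbar u : Measure A)) (C := 1) (fun u => ?_) ?_
  · have h0 : ∫ i, ∫ a, regret τ (G.payoff i) a ∂(gbar (G.payoff i) : Measure A)
        ∂(G.lam : Measure I) = 0 := integral_eq_zero_of_ae hNash.ae_integral_regret_eq_zero
    rwa [h0] at h
  · rw [abs_of_nonneg (integral_nonneg fun a => regret_nonneg _ _ a)]
    calc ∫ a, regret τ u a ∂(gbar u : Measure A) ≤ ∫ _, (1 : ℝ) ∂(gbar u : Measure A) :=
          integral_mono ((regret τ u).integrable _) (integrable_const _)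
            fun a => regret_le_one τ u a
      _ = 1 := by simp
  · filter_upwards [hcont] with u hu
    exact tendsto_integral_of_tendsto ((continuous_regret τ).continuousAt.mono_left
      nhdsWithin_le_nhds) hu

/-- Realizations of the direct strategy profiles fail to be pure-strategy `ε`-Nash equilibria with
probability tending to zero. -/
lemma tendsto_measure_not_isPureEpsNash {τ : ProbabilityMeasure A}
    (hgbar : G.IsAuxiliaryMapping τ gbar) (hS : ∀ n i, Gn n i ∈ S)
    (hSμ : ∀ᵐ u ∂(G.charDist : Measure (Payoff A)), u ∈ S)
    (hconv : Tendsto (fun n => empirical (Gn n)) l (𝓝 G.charDist))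
    (hcont : ∀ᵐ u ∂(G.charDist : Measure (Payoff A)), ContinuousWithinAt gbar S u)
    (hcard : Tendsto (fun n => (Fintype.card (P n) : ℝ)⁻¹) l (𝓝 0))
    {Ω : Type*} [MeasurableSpace Ω] (Pr : Measure Ω) [IsProbabilityMeasure Pr]
    {x : ∀ n, P n → Ω → A} (hx : ∀ n i, Measurable (x n i))
    (hlaw : ∀ n i, Pr.map (x n i) = (gbar (Gn n i) : Measure A))
    (hindep : ∀ n, Pairwise fun i j => IndepFun (x n i) (x n j) Pr) {ε : ℝ} (hε : 0 < ε) :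
    Tendsto (fun n => Pr {ω | ¬ IsPureEpsNash (Gn n) ε fun i => x n i ω}) l (𝓝 0) := by
  have hlaw' : ∀ n i (f : A →ᵇ ℝ),
      ∫ ω, f (x n i ω) ∂Pr = ∫ a, f a ∂(gbar (Gn n i) : Measure A) := fun n i f => by
    rw [← hlaw, integral_map (hx n i).aemeasurable f.continuous.measurable.aestronglyMeasurable]
  -- `δ ≤ 1` makes the truncations harmless; `3 * δ ≤ ε` pays for the three errors of
  -- `isPureEpsNash_of_mean_lt`.
  set δ := min 1 (ε / 3) with hδ
  have hδ0 : 0 < δ := by positivity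
  have hδ1 : δ ≤ 1 := min_le_left _ _
  have hδε : 3 * δ ≤ ε := by linarith [min_le_right 1 (ε / 3)]
  -- Half of the budget `δ * ε` goes to the oscillation, half to the regret.
  set η := δ * ε / 2 with hη
  have hη0 : 0 < η := by positivity
  obtain ⟨U, hU, hUη⟩ := exists_mem_nhds_integral_oscillation_lt τ G.charDist hη0
  have hosc := tendsto_mean_of_tendsto_empirical hS hSμ hconv (F := oscillation τ U) (C := 1)
    (abs_oscillation_le_one τ U)
    (Eventually.of_forall fun u => (continuous_oscillation τ U).continuousWithinAt)
  rw [integral_charDist (continuous_oscillation τ U).measurable.aestronglyMeasurable] at hUη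
  have hdev := tendsto_measure_not_deviationDists_subset Pr hcard hx hindep (τ := τ)
    (by simpa only [hlaw'] using tendsto_mean_integral hgbar hS hSμ hconv hcont) hU
  set Y : ∀ n, Ω → ℝ := fun n ω =>
    (Fintype.card (P n) : ℝ)⁻¹ * ∑ i, regret τ (Gn n i) (x n i ω) with hY
  have hYint : Tendsto (fun n => ∫ ω, Y n ω ∂Pr) l (𝓝 0) := by
    refine (tendsto_mean_regret hgbar hS hSμ hconv hcont).congr fun n => ?_
    rw [hY, integral_const_mul, integral_finsetSum]
    · simp only [hlaw']
    · intro i _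
      exact Integrable.of_bound
        ((regret τ (Gn n i)).continuous.measurable.comp (hx n i)).aestronglyMeasurable
        ‖regret τ (Gn n i)‖ (Eventually.of_forall fun ω => (regret τ (Gn n i)).norm_coe_le_norm _)
  -- `Y n` is nonnegative with mean tending to zero, so no independence is needed here.
  have hYmarkov : ∀ n, Pr {ω | η ≤ Y n ω} ≤ ENNReal.ofReal (η⁻¹ * ∫ ω, Y n ω ∂Pr) := by
    intro n
    have hm : Measurable (Y n) := Measurable.const_mul (Finset.measurable_fun_sum _ fun i _ =>
      (regret τ (Gn n i)).continuous.measurable.comp (hx n i)) _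
    have hJ : (0 : ℝ) < Fintype.card (P n) := by exact_mod_cast Fintype.card_pos
    have h0 : ∀ ω, 0 ≤ Y n ω := fun ω =>
      mul_nonneg (by positivity) (Finset.sum_nonneg fun i _ => regret_nonneg _ _ _)
    have h1 : ∀ ω, Y n ω ≤ 1 := fun ω => by
      rw [hY, inv_mul_le_iff₀ hJ]
      exact (Finset.sum_le_sum fun i _ => regret_le_one τ (Gn n i) (x n i ω)).trans (by simp)
    have h := mul_meas_ge_le_integral_of_nonneg (μ := Pr) (f := Y n) (Eventually.of_forall h0)
      (Integrable.of_bound hm.aestronglyMeasurable 1 (Eventually.of_forall fun ω => by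
        rw [Real.norm_of_nonneg (h0 ω)]; exact h1 ω)) η
    rw [← ofReal_measureReal]
    exact ENNReal.ofReal_le_ofReal ((le_inv_mul_iff₀ hη0).2 h)
  have hYlim : Tendsto (fun n => ENNReal.ofReal (η⁻¹ * ∫ ω, Y n ω ∂Pr)) l (𝓝 0) := by
    simpa using ENNReal.tendsto_ofReal (hYint.const_mul η⁻¹)
  have hsum := hdev.add hYlim
  rw [add_zero] at hsum
  refine tendsto_of_tendsto_of_tendsto_of_le_of_le' tendsto_const_nhds hsum
    (Eventually.of_forall fun _ => zero_le) ?_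
  filter_upwards [hosc.eventually_lt_const hUη] with n hn
  refine le_trans (measure_mono fun ω hω => ?_)
    ((measure_union_le _ _).trans (add_le_add_right (hYmarkov n) _))
  by_contra hnot
  simp only [Set.mem_union, Set.mem_ofPred_eq, not_or, not_not, not_le] at hnot hω
  obtain ⟨hsub, hYω⟩ := hnot
  refine hω (isPureEpsNash_of_mean_lt hδε hδ0 (r := fun i => regret τ (Gn n i) (x n i ω))
    (o := fun i => oscillation τ U (Gn n i)) (fun i => regret_nonneg _ _ _)
    (fun i => oscillation_nonneg _ _ _) (fun i hi => le_add_of_regret_lt hδ1 hi)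
    (fun i hi a ν hν => abs_sub_le_of_oscillation_lt hδ1 hi a hν) (hsub (Set.mem_insert _ _))
    (fun i a => hsub (Set.mem_insert_of_mem _ ⟨(i, a), rfl⟩)) ?_)
  have h1 : (Fintype.card (P n) : ℝ)⁻¹ * ∑ i, regret τ (Gn n i) (x n i ω) < η := hYω
  linarith

end DirectStrategies

end LargeGames

/-! ### The theorem. -/

theorem theorem2
    {A : Type*} [MetricSpace A] [CompactSpace A] [MeasurableSpace A] [BorelSpace A]
    {I : Type*} [MeasurableSpace I] (G : LargeGames.LargeGame I A)
    -- the finite-player games: `P n` is the set of players, with `n` elements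
    {P : ℕ+ → Type*} [∀ n, Fintype (P n)] [∀ n, Nonempty (P n)]
    (hcard : ∀ n, Fintype.card (P n) = (n : ℕ))
    (Gn : ∀ n, P n → LargeGames.Payoff A)
    (hsupp : ∀ n i, Gn n i ∈ (G.charDist : Measure (LargeGames.Payoff A)).support)
    (hconv : Tendsto (fun n => LargeGames.empirical (Gn n)) atTop (𝓝 G.charDist))
    -- the auxiliary mapping
    (τ : ProbabilityMeasure A) (hτ : G.IsEquilibriumDist τ)
    (gbar : LargeGames.Payoff A → ProbabilityMeasure A) (hgbar : G.IsAuxiliaryMapping τ gbar)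
    (hcont : ∀ᵐ u ∂(G.charDist : Measure (LargeGames.Payoff A)),
      u ∈ (G.charDist : Measure (LargeGames.Payoff A)).support →
        ContinuousWithinAt gbar (G.charDist : Measure (LargeGames.Payoff A)).support u)
    -- the realizations of the direct strategy profiles `gbar ∘ Gn n`
    {Ω : Type*} [MeasurableSpace Ω] (Pr : Measure Ω) [IsProbabilityMeasure Pr]
    (x : ∀ n, P n → Ω → A) (hx : ∀ n i, Measurable (x n i))
    (hlaw : ∀ n i, Pr.map (x n i) = (gbar (Gn n i) : Measure A))
    (hindep : ∀ n, Pairwise fun i j => IndepFun (x n i) (x n j) Pr)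
    (ε : ℝ) (hε : 0 < ε) :
    (∀ n, MeasurableSet {ω | LargeGames.IsPureEpsNash (Gn n) ε fun i => x n i ω}) ∧
      Tendsto (fun n => Pr {ω | LargeGames.IsPureEpsNash (Gn n) ε fun i => x n i ω})
        atTop (𝓝 1) := by
  have hmeas : ∀ n, MeasurableSet {ω | LargeGames.IsPureEpsNash (Gn n) ε fun i => x n i ω} :=
    fun n => (measurable_pi_lambda (fun ω i => x n i ω) (hx n))
      (LargeGames.isClosed_setOf_isPureEpsNash (Gn n) ε).measurableSet
  refine ⟨hmeas, ?_⟩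
  -- The support has full measure because it is closed and carries every approximating empirical
  -- measure.
  have hSμ := LargeGames.ae_mem_of_tendsto hconv Measure.isClosed_support
    fun n => LargeGames.ae_empirical (hsupp n)
  have hcard' : Tendsto (fun n => (Fintype.card (P n) : ℝ)⁻¹) atTop (𝓝 0) := by
    simp only [hcard]
    exact tendsto_inv_atTop_zero.comp
      (tendsto_natCast_atTop_atTop.comp tendsto_PNat_val_atTop_atTop)
  have hbad := LargeGames.tendsto_measure_not_isPureEpsNash hgbar hsupp hSμ hconv
    (by filter_upwards [hcont, hSμ] with u hu hSu using hu hSu) hcard' Pr hx hlaw hindep hε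
  have hgood := ENNReal.Tendsto.sub tendsto_const_nhds hbad (Or.inl ENNReal.one_ne_top)
  rw [tsub_zero] at hgood
  refine hgood.congr fun n => ?_
  have h := prob_compl_eq_one_sub (μ := Pr) (hmeas n).compl
  rw [compl_compl] at h
  exact h.symm
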